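/- Let $n \ge 0$ and let $\nu$ be a probability measure on $\{\pm 1\}^n$; write $X=(X_1,\dots,X_n)$ for the coordinates and $m(\nu)=\mathbb{E}_\nu[X]\in\mathbb{R}^n$ for the mean vector. Fix $c\in(0,1]$ and $\alpha>0$. Let $\mathrm{Sparse}_c$ be the set of $v\in\mathbb{R}^n$ with at most $\lceil cn\rceil$ nonzero coordinates, and let $\mathrm{sign}(\mathrm{Sparse}_c)$ be the set of $u\in\{-1,0,1\}^n$ for which there is $v\in\mathrm{Sparse}_c$ with $u_i\in\{0,\mathrm{sign}(v_i)\}$ for all $i$ (equivalently, the $u\in\{-1,0,1\}^n$ with at most $\lceil cn\rceil$ nonzero coordinates). Call $u\in\{-1,0,1\}^n$ feasible if the event $\{X_i=u_i \text{ for all } i \text{ with } u_i\neq 0\}$ has positive $\nu$-probability, and then let $\mathcal{R}_u\nu$ be $\nu$ conditioned on this event. For a probability measure $\pi$ on $\{\pm1\}^n$ let $A(\pi)=\{i:\mathrm{Var}_\pi(X_i)>0\}$ and let $\Psi(\pi)$ be the real matrix indexed by $A(\pi)\times A(\pi)$ with $$\Psi(\pi)=\mathrm{Cov}(\pi)\,\mathrm{diag}\bigl(\mathrm{Var}_\pi(X_i)\bigr)^{-1},\qquad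 \text{i.e. } \Psi(\pi)_{ij}=\frac{\mathrm{Cov}_\pi(X_i,X_j)}{\mathrm{Var}_\pi(X_j)}.$$ Suppose that $\nu$ is $\alpha$-$\ell_2$-independent restricted to $\mathrm{sign}(\mathrm{Sparse}_c)$, that is, $\|\Psi(\mathcal{R}_u\nu)\|_{\mathrm{op}}\le\alpha$ for every feasible $u\in\mathrm{sign}(\mathrm{Sparse}_c)$, where $\|\cdot\|_{\mathrm{op}}$ is the $\ell_2\to\ell_2$ operator norm. Then for every probability measure $\mu$ on $\{\pm1\}^n$ with $\mu\ll\nu$, $$\|m(\mu)-m(\nu)\|_2^2\;\le\;\frac{8\alpha}{c}\,\mathrm{KL}(\mu\|\nu),\qquad \mathrm{KL}(\mu\|\nu)=\sum_{x}\mu(x)\log\frac{\mu(x)}{\nu(x)}\quad(\text{with } 0\log 0:=0,\ \text{summing over } \nu(x)>0).$$ -/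

import Mathlib

open MeasureTheory ProbabilityTheory

noncomputable section

namespace SparseLoc

/-- The discrete cube `{±1}^n`; `ℤˣ = {1, -1}`. It carries Mathlib's product measurable space. -/
abbrev Cube (n : ℕ) : Type := Fin n → ℤˣ

/-- Every subset of the sign set `{1, -1}` is measurable for the measurable space that Mathlib
puts on it (so every subset of the cube is measurable too). -/
instance instDiscreteSign : DiscreteMeasurableSpace ℤˣ :=
  ⟨fun s => ⟨(fun x : ℤˣ => (x : ℤ)) '' s, MeasurableSet.of_discrete,
    Set.preimage_image_eq s Units.val_injective⟩⟩

variable {n : ℕ}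

/-- The `i`-th coordinate random variable `X_i` on the cube, as a real number. -/
def coord (i : Fin n) (x : Cube n) : ℝ := ((x i : ℤ) : ℝ)

/-- The mean vector `m(ν) = 𝔼_ν[X]`, in Euclidean space. -/
def mean (ν : Measure (Cube n)) : EuclideanSpace ℝ (Fin n) :=
  WithLp.toLp 2 (fun i => ∫ x, coord i x ∂ν)

/-- The event `{X_i = u_i for all i with u_i ≠ 0}` for `u ∈ {-1, 0, 1}^n`. -/
def pinEvent (u : Fin n → SignType) : Set (Cube n) :=
  {x | ∀ i, u i ≠ 0 → (x i : ℤ) = (u i : ℤ)}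

/-- The pinning operator `R_u`: conditioning on the event `pinEvent u`. It is meaningful when `u`
is feasible, i.e. when that event has positive probability. -/
def pin (u : Fin n → SignType) (ν : Measure (Cube n)) : Measure (Cube n) :=
  ProbabilityTheory.cond ν (pinEvent u)

/-- The active coordinates: those with positive variance under `ν`. -/
def active (ν : Measure (Cube n)) : Finset (Fin n) :=
  Finset.univ.filter (fun i => 0 < variance (coord i) ν)

/-- The covariance matrix of `ν`, restricted to the active coordinates. -/
def covMatrix (ν : Measure (Cube n)) : Matrix (active ν) (active ν) ℝ :=
  Matrix.of fun i j => covariance (coord (i : Fin n)) (coord (j : Fin n)) ν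

/-- The influence matrix `Ψ(ν) = Cov(ν) diag(Var_ν(X_i))⁻¹`, on the active coordinates. -/
def influence (ν : Measure (Cube n)) : Matrix (active ν) (active ν) ℝ :=
  covMatrix ν * Matrix.diagonal (fun j : active ν => (variance (coord (j : Fin n)) ν)⁻¹)

/-- The `ℓ²`-operator norm `‖Ψ(ν)‖_op` of the influence matrix on the active subspace. -/
def influenceOpNorm (ν : Measure (Cube n)) : ℝ :=
  ‖Matrix.toEuclideanCLM (n := active ν) (𝕜 := ℝ) (influence ν)‖

/-- `ν` is `α`-`ℓ₂`-independent restricted to `S ⊆ {-1, 0, 1}^n`: for every feasible `u ∈ S`,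
`‖Ψ(R_u ν)‖_op ≤ α`. -/
def L2IndepOn (α : ℝ) (S : Set (Fin n → SignType)) (ν : Measure (Cube n)) : Prop :=
  ∀ u ∈ S, ν (pinEvent u) ≠ 0 → influenceOpNorm (pin u ν) ≤ α

/-- `sign(V) ⊆ {-1, 0, 1}^n`, the downward closure of the sign vectors of elements of `V`. -/
def signSet (V : Set (EuclideanSpace ℝ (Fin n))) : Set (Fin n → SignType) :=
  {s | ∃ v ∈ V, ∀ i, s i = 0 ∨ s i = SignType.sign (v i)}

/-- `Sparse_c`: the vectors of `ℝ^n` with at most `⌈c n⌉` nonzero coordinates. -/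
def sparse (n : ℕ) (c : ℝ) : Set (EuclideanSpace ℝ (Fin n)) :=
  {v | {i | v i ≠ 0}.ncard ≤ ⌈c * n⌉₊}

end SparseLoc

end

/-!
Write `δ = mean μ - mean ν` and `Ψ` for the influence matrix of `ν`, extended by zero. The proof
reveals the coordinates of a sample of `μ` one at a time, each chosen uniformly among all `n`
coordinates, for `⌈c n⌉` rounds, so that only pinnings of at most `⌈c n⌉` coordinates occur.

Revealing coordinate `i` splits the relative entropy (`relEntropy_chain`) into the entropy of the
marginals of `X_i`, which is at least `δ_i ^ 2 / 2` by Pinsker's inequality (`half_sq_le_sum_face`),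
and the average relative entropy of the pinned pair. The average mean difference of the pinned pair
is `δ - δ_i Ψ e_i` (`sum_face_mean_sub`), because `Cov(X, X_i) / Var(X_i)` is half the difference of
the conditional means given `X_i = ± 1`. If the pinned pairs satisfy
`κ ‖mean difference‖ ^ 2 ≤ entropy`, then bounding the squared norm from below by its tangent at `δ`
and summing over `i` gives (`relEntropy_step`)
`n * relEntropy μ ν ≥ ‖δ‖ ^ 2 / 2 + κ (n ‖δ‖ ^ 2 - 2 ⟪δ, Ψ δ⟫) ≥ (1 / 2 + κ (n - 2 α)) ‖δ‖ ^ 2`.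

By induction, `k` rounds yield the constant `k / (2 (n + 2 α k))`
(`norm_mean_sub_sq_le_of_pinIndep`). For `k ≥ c n` this is at least `c / (8 α)` as soon as `α ≥ 1`,
which holds unless `ν` is a point mass (`one_le_influenceOpNorm`), where `μ = ν`.
-/

open MeasureTheory ProbabilityTheory
noncomputable section
namespace SparseLoc
variable {n : ℕ}

/-! ### Finite sums on the cube -/

/-- The face `{X_i = s}` of the cube. -/
def face (i : Fin n) (s : ℤˣ) : Set (Cube n) := {x | x i = s}

@[simp] lemma mem_face {i : Fin n} {s : ℤˣ} {x : Cube n} : x ∈ face i s ↔ x i = s := Iff.rfl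

lemma integral_eq_sum (ν : Measure (Cube n)) [IsFiniteMeasure ν] (f : Cube n → ℝ) :
    ∫ x, f x ∂ν = ∑ x, ν.real {x} * f x := by
  simpa using integral_fintype (μ := ν) (f := f) Integrable.of_finite

lemma sum_face (i : Fin n) (f : Cube n → ℝ) :
    ∑ s : ℤˣ, ∑ x, (if x i = s then f x else 0) = ∑ x, f x := by
  rw [Finset.sum_comm]
  simp only [Finset.sum_ite_eq, Finset.mem_univ, if_true]

lemma real_face (ν : Measure (Cube n)) [IsFiniteMeasure ν] (i : Fin n) (s : ℤˣ) :
    ν.real (face i s) = ∑ x, if x i = s then ν.real {x} else 0 := by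
  have h := integral_eq_sum ν ((face i s).indicator 1)
  rw [integral_indicator_one MeasurableSet.of_discrete] at h
  rw [h]
  refine Finset.sum_congr rfl fun x _ => ?_
  by_cases hx : x i = s <;> simp [Set.indicator, hx]

lemma sum_real_face (ν : Measure (Cube n)) [IsProbabilityMeasure ν] (i : Fin n) :
    ν.real (face i 1) + ν.real (face i (-1)) = 1 := by
  have h := sum_face i fun x => ν.real {x}
  simpa [← real_face] using h

lemma integral_coord (ν : Measure (Cube n)) [IsFiniteMeasure ν] (i : Fin n) :
    ∫ x, coord i x ∂ν = ν.real (face i 1) - ν.real (face i (-1)) := by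
  rw [integral_eq_sum, real_face, real_face, ← Finset.sum_sub_distrib]
  refine Finset.sum_congr rfl fun x _ => ?_
  rcases Int.units_eq_one_or (x i) with h | h <;> simp [coord, h]

lemma real_eq_zero_of_ac {μ ν : Measure (Cube n)} [IsFiniteMeasure μ] [IsFiniteMeasure ν]
    (h : μ ≪ ν) {E : Set (Cube n)} (hE : ν.real E = 0) : μ.real E = 0 := by
  rw [measureReal_eq_zero_iff] at *
  exact h hE

lemma real_face_mul_cond (ν : Measure (Cube n)) [IsFiniteMeasure ν] (i : Fin n) (s : ℤˣ)
    (x : Cube n) :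
    ν.real (face i s) * (ν[|face i s]).real {x} = if x i = s then ν.real {x} else 0 := by
  have h := cond_mul_eq_inter (MeasurableSet.of_discrete (s := face i s)) {x} ν
  have h' := congrArg ENNReal.toReal h
  rw [ENNReal.toReal_mul] at h'
  rw [mul_comm]
  refine h'.trans ?_
  split_ifs with hx
  · rw [Set.inter_eq_right.2 (by simpa using hx)]; rfl
  · rw [Set.inter_singleton_eq_empty.2 (by simpa using hx)]; simp

lemma real_face_mul_integral_cond (ν : Measure (Cube n)) [IsFiniteMeasure ν] (i : Fin n) (s : ℤˣ)
    (f : Cube n → ℝ) :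
    ν.real (face i s) * ∫ x, f x ∂ν[|face i s]
      = ∑ x, if x i = s then ν.real {x} * f x else 0 := by
  rw [integral_eq_sum, Finset.mul_sum]
  refine Finset.sum_congr rfl fun x _ => ?_
  rw [← mul_assoc, real_face_mul_cond, ite_mul, zero_mul]

/-! ### Relative entropy -/

/-- The relative entropy `∑ x, μ(x) log (μ(x) / ν(x))` as a finite sum; the conventions
`0 * log 0 = 0` and `a / 0 = 0` make terms with `μ(x) = 0` vanish. -/
def relEntropy (μ ν : Measure (Cube n)) : ℝ :=
  ∑ x, μ.real {x} * Real.log (μ.real {x} / ν.real {x})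

lemma toReal_klDiv_eq_relEntropy {μ ν : Measure (Cube n)} [IsProbabilityMeasure μ]
    [IsProbabilityMeasure ν] (h : μ ≪ ν) :
    (InformationTheory.klDiv μ ν).toReal = relEntropy μ ν := by
  rw [InformationTheory.toReal_klDiv_of_measure_eq h (by simp), integral_eq_sum, relEntropy]
  refine Finset.sum_congr rfl fun x _ => ?_
  by_cases hx : ν {x} = 0
  · simp [measureReal_def, h hx]
  have hd : μ.rnDeriv ν x * ν {x} = μ {x} := by
    rw [← lintegral_singleton, ← withDensity_apply _ (measurableSet_singleton x),
      Measure.withDensity_rnDeriv_eq μ ν h]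
  have hd' : (μ.rnDeriv ν x).toReal * ν.real {x} = μ.real {x} := by
    simpa [measureReal_def] using congrArg ENNReal.toReal hd
  have hx' : ν.real {x} ≠ 0 := by simpa [measureReal_eq_zero_iff] using hx
  rw [llr, ← hd', mul_div_cancel_right₀ _ hx']

/-- The tangent-line form of the Gibbs variational inequality. -/
lemma mul_sub_log_le {p q t : ℝ} (hp : 0 ≤ p) (hq : 0 ≤ q) (h : q = 0 → p = 0) :
    p * (t - Real.log (p / q)) ≤ q * Real.exp t - p := by
  rcases hp.eq_or_lt with rfl | hp
  · simpa using mul_nonneg hq (Real.exp_pos t).le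
  have hq : 0 < q := hq.lt_of_ne fun h0 => hp.ne' (h h0.symm)
  have h1 := Real.log_le_sub_one_of_pos (x := q * Real.exp t / p) (by positivity)
  rw [Real.log_div (by positivity) hp.ne', Real.log_mul hq.ne' (Real.exp_pos t).ne',
    Real.log_exp] at h1
  rw [Real.log_div hp.ne' hq.ne']
  calc p * (t - (Real.log p - Real.log q)) ≤ p * (q * Real.exp t / p - 1) :=
        mul_le_mul_of_nonneg_left (by linarith) hp.le
    _ = _ := by field_simp

/-- Hoeffding's lemma for one coordinate. -/
lemma sum_face_exp_le (ν : Measure (Cube n)) [IsProbabilityMeasure ν] (i : Fin n) (t : ℝ) :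
    ∑ s : ℤˣ, ν.real (face i s) * Real.exp (t * ((s : ℤ) - ∫ x, coord i x ∂ν))
      ≤ Real.exp (t ^ 2 / 2) := by
  have h := (hasSubgaussianMGF_of_mem_Icc (μ := ν) (X := coord i) (a := -1) (b := 1)
    Measurable.of_discrete.aemeasurable (.of_forall fun x => by
      rcases Int.units_eq_one_or (x i) with h | h <;> simp [coord, h])).mgf_le t
  rw [mgf, integral_eq_sum] at h
  convert h using 1
  · rw [← sum_face i]
    refine Finset.sum_congr rfl fun s _ => ?_
    rw [real_face, Finset.sum_mul]
    refine Finset.sum_congr rfl fun x _ => ?_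
    split_ifs with hx
    · simp [coord, hx]
    · simp
  · norm_num

/-- Pinsker's inequality for one coordinate. -/
lemma half_sq_le_sum_face {μ ν : Measure (Cube n)} [IsProbabilityMeasure μ]
    [IsProbabilityMeasure ν] (h : μ ≪ ν) (i : Fin n) :
    (∫ x, coord i x ∂μ - ∫ x, coord i x ∂ν) ^ 2 / 2
      ≤ ∑ s : ℤˣ, μ.real (face i s) * Real.log (μ.real (face i s) / ν.real (face i s)) := by
  set d := ∫ x, coord i x ∂μ - ∫ x, coord i x ∂ν with hd
  set b := ∫ x, coord i x ∂ν with hb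
  have h1 := Finset.sum_le_sum fun (s : ℤˣ) (_ : s ∈ Finset.univ) =>
    mul_sub_log_le (p := μ.real (face i s)) (q := ν.real (face i s))
      -- the optimal multiplier in the variational formula is the mean difference `d`
      (t := d * ((s : ℤ) - b) - d ^ 2 / 2)
      measureReal_nonneg measureReal_nonneg (real_eq_zero_of_ac h)
  have h2 : ∑ s : ℤˣ, ν.real (face i s) * Real.exp (d * ((s : ℤ) - b) - d ^ 2 / 2) ≤ 1 := by
    simp_rw [Real.exp_sub, ← mul_div_assoc]
    rw [← Finset.sum_div]
    exact (div_le_one (Real.exp_pos _)).2 (sum_face_exp_le ν i d)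
  have h3 := sum_real_face μ i
  have h4 := integral_coord μ i
  simp only [UnitsInt.univ, Finset.sum_pair (show (1 : ℤˣ) ≠ -1 by decide)] at h1 h2 ⊢
  push_cast at h1 h2
  have h5 : d + b = μ.real (face i 1) - μ.real (face i (-1)) := by rw [← h4, hd]; ring
  have h6 : μ.real (face i 1) = (1 + d + b) / 2 := by linarith
  have h7 : μ.real (face i (-1)) = (1 - d - b) / 2 := by linarith
  have h8 : μ.real (face i 1) * (d * (1 - b) - d ^ 2 / 2)
      + μ.real (face i (-1)) * (d * (-1 - b) - d ^ 2 / 2) = d ^ 2 / 2 := by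
    rw [h6, h7]; ring
  simp only [mul_sub (μ.real _)] at h1 h8
  linarith

/-- The chain rule for relative entropy, revealing one coordinate. -/
lemma relEntropy_chain {μ ν : Measure (Cube n)} [IsProbabilityMeasure μ]
    [IsProbabilityMeasure ν] (h : μ ≪ ν) (i : Fin n) :
    relEntropy μ ν
      = ∑ s : ℤˣ, μ.real (face i s) * Real.log (μ.real (face i s) / ν.real (face i s))
        + ∑ s : ℤˣ, μ.real (face i s) * relEntropy (μ[|face i s]) (ν[|face i s]) := by
  rw [relEntropy, ← Finset.sum_add_distrib, ← sum_face i]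
  refine Finset.sum_congr rfl fun s _ => ?_
  have h0 : μ.real (face i s) * Real.log (μ.real (face i s) / ν.real (face i s))
      = ∑ x, (if x i = s then μ.real {x} else 0)
          * Real.log (μ.real (face i s) / ν.real (face i s)) := by
    rw [← Finset.sum_mul, ← real_face]
  rw [relEntropy, Finset.mul_sum, h0, ← Finset.sum_add_distrib]
  refine Finset.sum_congr rfl fun x _ => ?_
  have hμ := real_face_mul_cond μ i s x
  have hν := real_face_mul_cond ν i s x
  rw [← mul_assoc, hμ]
  split_ifs with hx
  swap; · simp
  rw [if_pos hx] at hμ hν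
  rcases eq_or_ne (μ.real {x}) 0 with h0 | h0
  · simp [h0]
  have h1 : ν.real {x} ≠ 0 := fun h' => h0 (real_eq_zero_of_ac h h')
  rw [← hμ] at h0 ⊢
  rw [← hν] at h1 ⊢
  obtain ⟨h2, h3⟩ := mul_ne_zero_iff.1 h0
  obtain ⟨h4, h5⟩ := mul_ne_zero_iff.1 h1
  rw [← mul_add, mul_div_mul_comm, Real.log_mul (div_ne_zero h2 h4) (div_ne_zero h3 h5)]

/-! ### Drift of the mean under pinning one coordinate -/

lemma integral_coord_mul (ν : Measure (Cube n)) [IsFiniteMeasure ν] (i j : Fin n) :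
    ∫ x, coord j x * coord i x ∂ν
      = ν.real (face i 1) * ∫ x, coord j x ∂ν[|face i 1]
        - ν.real (face i (-1)) * ∫ x, coord j x ∂ν[|face i (-1)] := by
  rw [real_face_mul_integral_cond, real_face_mul_integral_cond, integral_eq_sum,
    ← Finset.sum_sub_distrib]
  refine Finset.sum_congr rfl fun x _ => ?_
  rcases Int.units_eq_one_or (x i) with h | h <;> simp [coord, h]

lemma integral_eq_sum_cond (ν : Measure (Cube n)) [IsFiniteMeasure ν] (i : Fin n)
    (f : Cube n → ℝ) :
    ∫ x, f x ∂ν = ν.real (face i 1) * ∫ x, f x ∂ν[|face i 1]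
        + ν.real (face i (-1)) * ∫ x, f x ∂ν[|face i (-1)] := by
  rw [real_face_mul_integral_cond, real_face_mul_integral_cond, integral_eq_sum,
    ← sum_face i]
  simp

lemma covariance_coord (ν : Measure (Cube n)) [IsProbabilityMeasure ν] (i j : Fin n) :
    covariance (coord j) (coord i) ν
      = ∫ x, coord j x * coord i x ∂ν - (∫ x, coord j x ∂ν) * ∫ x, coord i x ∂ν := by
  exact covariance_eq_sub MemLp.of_discrete MemLp.of_discrete

lemma variance_coord (ν : Measure (Cube n)) [IsProbabilityMeasure ν] (i : Fin n) :
    variance (coord i) ν = 4 * ν.real (face i 1) * ν.real (face i (-1)) := by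
  have h1 : ∀ x : Cube n, coord i x * coord i x = 1 := fun x => by
    rcases Int.units_eq_one_or (x i) with h | h <;> simp [coord, h]
  rw [← covariance_self Measurable.of_discrete.aemeasurable, covariance_coord, integral_coord]
  simp only [h1, integral_const, probReal_univ, smul_eq_mul, mul_one]
  linear_combination (-1 - ν.real (face i 1) - ν.real (face i (-1))) * sum_real_face ν i

/-- Revealing coordinate `i` according to `μ` moves the mean difference, on average, along the
`i`-th column of the influence matrix: `(𝔼[X ∣ X_i = 1] - 𝔼[X ∣ X_i = -1]) / 2` is the regression
slope `Cov(X, X_i) / Var(X_i)`. The identity also holds for deterministic coordinates, where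
both `0⁻¹ = 0` and the mean difference vanish. -/
lemma sum_face_mean_sub {μ ν : Measure (Cube n)} [IsProbabilityMeasure μ]
    [IsProbabilityMeasure ν] (h : μ ≪ ν) (i j : Fin n) :
    ∑ s : ℤˣ, μ.real (face i s) *
        (∫ x, coord j x ∂μ[|face i s] - ∫ x, coord j x ∂ν[|face i s])
      = (∫ x, coord j x ∂μ - ∫ x, coord j x ∂ν)
        - covariance (coord j) (coord i) ν * (variance (coord i) ν)⁻¹
          * (∫ x, coord i x ∂μ - ∫ x, coord i x ∂ν) := by
  have hP := sum_real_face μ i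
  have hQ := sum_real_face ν i
  have h1 := real_eq_zero_of_ac h (E := face i 1)
  have h2 := real_eq_zero_of_ac h (E := face i (-1))
  rw [covariance_coord, variance_coord, integral_coord_mul, integral_eq_sum_cond μ i (coord j),
    integral_eq_sum_cond ν i (coord j), integral_coord μ i, integral_coord ν i]
  simp only [UnitsInt.univ, Finset.sum_pair (show (1 : ℤˣ) ≠ -1 by decide)]
  generalize ∫ x, coord j x ∂μ[|face i 1] = a₁
  generalize ∫ x, coord j x ∂μ[|face i (-1)] = a₂
  generalize ∫ x, coord j x ∂ν[|face i 1] = b₁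
  generalize ∫ x, coord j x ∂ν[|face i (-1)] = b₂
  generalize μ.real (face i 1) = p₁ at *
  generalize μ.real (face i (-1)) = p₂ at *
  generalize ν.real (face i 1) = q₁ at *
  generalize ν.real (face i (-1)) = q₂ at *
  rcases eq_or_ne q₁ 0 with h3 | h3
  · obtain rfl : p₁ = 0 := h1 h3
    obtain rfl : q₂ = 1 := by linarith
    obtain rfl : p₂ = 1 := by linarith
    subst h3; ring
  rcases eq_or_ne q₂ 0 with h4 | h4
  · obtain rfl : p₂ = 0 := h2 h4
    obtain rfl : q₁ = 1 := by linarith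
    obtain rfl : p₁ = 1 := by linarith
    subst h4; ring
  obtain rfl : p₂ = 1 - p₁ := by linarith
  obtain rfl : q₂ = 1 - q₁ := by linarith
  field_simp
  ring

/-! ### The quadratic form of the influence matrix -/

lemma pin_zero (ν : Measure (Cube n)) [IsProbabilityMeasure ν] : pin 0 ν = ν := by
  have : pinEvent (0 : Fin n → SignType) = Set.univ := by ext x; simp [pinEvent]
  rw [pin, this, cond_univ]

/-- A coordinate that is deterministic under `ν` has the same mean under every `μ ≪ ν`. -/
lemma integral_coord_eq_of_notMem_active {μ ν : Measure (Cube n)} [IsProbabilityMeasure μ]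
    [IsProbabilityMeasure ν] (h : μ ≪ ν) {i : Fin n} (hi : i ∉ active ν) :
    ∫ x, coord i x ∂μ = ∫ x, coord i x ∂ν := by
  have h0 : variance (coord i) ν = 0 := by
    refine le_antisymm (not_lt.1 fun h' => hi ?_) (variance_nonneg _ _)
    simpa [active] using h'
  have hP := sum_real_face μ i
  have hQ := sum_real_face ν i
  rw [variance_coord] at h0
  rw [integral_coord, integral_coord]
  rcases mul_eq_zero.1 h0 with h1 | h1
  · have h1 : ν.real (face i 1) = 0 := by linarith
    have := real_eq_zero_of_ac h h1
    linarith
  · have := real_eq_zero_of_ac h h1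
    linarith

lemma influence_apply (ν : Measure (Cube n)) (i j : active ν) :
    influence ν i j = covariance (coord (i : Fin n)) (coord (j : Fin n)) ν
      * (variance (coord (j : Fin n)) ν)⁻¹ := by
  simp [influence, covMatrix, Matrix.mul_diagonal]

/-- A vector supported on the active coordinates sees the zero-extended influence matrix as a
quadratic form bounded by the operator norm. -/
lemma sum_influence_le (ν : Measure (Cube n)) (d : Fin n → ℝ) (hd : ∀ i ∉ active ν, d i = 0) :
    ∑ i, ∑ j, d j * (covariance (coord j) (coord i) ν * (variance (coord i) ν)⁻¹ * d i)
      ≤ influenceOpNorm ν * ∑ i, d i ^ 2 := by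
  set w : EuclideanSpace ℝ (active ν) := WithLp.toLp 2 fun i => d i with hw
  have restrict : ∀ f : Fin n → ℝ, (∀ i, d i = 0 → f i = 0) → ∑ i, f i = ∑ i : active ν, f i := by
    intro f hf
    rw [Finset.sum_coe_sort (active ν) f]
    exact (Finset.sum_subset (Finset.subset_univ _) fun i _ hi => hf i (hd i hi)).symm
  have h1 : ∑ i, d i ^ 2 = ‖w‖ ^ 2 := by
    rw [EuclideanSpace.real_norm_sq_eq, restrict _ (by intro i hi; simp [hi])]
  have h2 : ∑ i, ∑ j, d j * (covariance (coord j) (coord i) ν * (variance (coord i) ν)⁻¹ * d i)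
      = inner ℝ w (Matrix.toEuclideanCLM (n := active ν) (𝕜 := ℝ) (influence ν) w) := by
    rw [restrict _ (by intro i hi; simp [hi])]
    refine (Finset.sum_congr rfl fun i _ => restrict _ (by intro j hj; simp [hj])).trans ?_
    rw [Finset.sum_comm, PiLp.inner_apply]
    refine Finset.sum_congr rfl fun j _ => ?_
    simp [Matrix.mulVec, dotProduct, influence_apply, hw, Finset.sum_mul]
    refine Finset.sum_congr rfl fun i _ => ?_
    ring
  rw [h1, h2, influenceOpNorm]
  calc _ ≤ ‖w‖ * ‖Matrix.toEuclideanCLM (n := active ν) (𝕜 := ℝ) (influence ν) w‖ :=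
        real_inner_le_norm _ _
    _ ≤ ‖w‖ * (‖Matrix.toEuclideanCLM (n := active ν) (𝕜 := ℝ) (influence ν)‖ * ‖w‖) := by
        gcongr; exact ContinuousLinearMap.le_opNorm _ _
    _ = _ := by ring

lemma norm_mean_sub_sq (μ ν : Measure (Cube n)) :
    ‖mean μ - mean ν‖ ^ 2 = ∑ i, (∫ x, coord i x ∂μ - ∫ x, coord i x ∂ν) ^ 2 := by
  simp [EuclideanSpace.real_norm_sq_eq, mean]

/-- If some coordinate is random, the influence matrix has a unit diagonal entry. -/
lemma one_le_influenceOpNorm {ν : Measure (Cube n)} (i : active ν) : 1 ≤ influenceOpNorm ν := by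
  have hv : 0 < variance (coord (i : Fin n)) ν := by simpa [active] using i.2
  have h := sum_influence_le ν (Pi.single (i : Fin n) 1) fun j hj => by
    rw [Pi.single_eq_of_ne]; rintro rfl; exact hj i.2
  simpa [Pi.single_apply, covariance_self Measurable.of_discrete.aemeasurable, hv.ne'] using h

/-! ### Pinning one coordinate at a time -/

/-- `ℓ₂`-independence of `ν` under all pinnings of at most `k` coordinates. -/
def PinIndep (α : ℝ) (k : ℕ) (ν : Measure (Cube n)) : Prop :=
  L2IndepOn α {u | (Finset.univ.filter fun i => u i ≠ 0).card ≤ k} ν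

lemma PinIndep.influenceOpNorm_le {α : ℝ} {k : ℕ} {ν : Measure (Cube n)}
    [IsProbabilityMeasure ν] (h : PinIndep α k ν) : influenceOpNorm ν ≤ α := by
  have h0 := h 0 (by simp) (by simp [pinEvent])
  rwa [pin_zero] at h0

/-- Pinning one coordinate uses up one unit of the budget of pinned coordinates. -/
lemma PinIndep.cond_face {α : ℝ} {k : ℕ} {ν : Measure (Cube n)} [IsProbabilityMeasure ν]
    (h : PinIndep α (k + 1) ν) (i : Fin n) (s : ℤˣ) : PinIndep α k (ν[|face i s]) := by
  intro u hu hpos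
  rw [cond_apply MeasurableSet.of_discrete] at hpos
  have hpos' := (mul_ne_zero_iff.1 hpos).2
  obtain ⟨y, hyi, hy⟩ := nonempty_of_measure_ne_zero hpos'
  rw [mem_face] at hyi
  have hs : ((SignType.sign (s : ℤ) : SignType) : ℤ) = s ∧ SignType.sign (s : ℤ) ≠ 0 := by
    rcases Int.units_eq_one_or s with rfl | rfl <;> simp
  have hE : face i s ∩ pinEvent u = pinEvent (Function.update u i (SignType.sign (s : ℤ))) := by
    ext x
    simp only [Set.mem_inter_iff, mem_face, pinEvent, Set.mem_ofPred_eq]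
    constructor
    · rintro ⟨hxi, hx⟩ j hj
      rcases eq_or_ne j i with rfl | hji
      · rw [Function.update_self, hs.1, hxi]
      · rw [Function.update_of_ne hji] at hj ⊢
        exact hx j hj
    · intro hx
      have hxi : x i = s := by
        have := hx i (by rw [Function.update_self]; exact hs.2)
        rw [Function.update_self, hs.1] at this
        exact Units.ext this
      refine ⟨hxi, fun j hj => ?_⟩
      rcases eq_or_ne j i with rfl | hji
      · rw [hxi, ← hyi]; exact hy j hj
      · have := hx j
        rw [Function.update_of_ne hji] at this
        exact this hj
  rw [hE] at hpos'
  have hcard : (Finset.univ.filter fun j =>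
      Function.update u i (SignType.sign (s : ℤ)) j ≠ 0).card ≤ k + 1 := by
    refine (Finset.card_le_card (t := insert i (Finset.univ.filter fun j => u j ≠ 0)) ?_).trans
      ((Finset.card_insert_le _ _).trans (Nat.add_le_add_right hu 1))
    intro j hj
    rcases eq_or_ne j i with rfl | hji
    · simp
    · simpa [Function.update_of_ne hji, hji] using hj
  have := h _ hcard hpos'
  rwa [pin, ← hE, ← cond_cond_eq_cond_inter MeasurableSet.of_discrete MeasurableSet.of_discrete]
    at this

lemma cond_ac {μ ν : Measure (Cube n)} [IsFiniteMeasure ν] (h : μ ≪ ν) (E : Set (Cube n)) :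
    μ[|E] ≪ ν[|E] := by
  refine Measure.AbsolutelyContinuous.mk fun t _ ht => ?_
  rw [cond_apply MeasurableSet.of_discrete] at ht ⊢
  rcases mul_eq_zero.1 ht with h0 | h0
  · exact absurd (ENNReal.inv_eq_zero.1 h0) (measure_ne_top _ _)
  · rw [h h0, mul_zero]

/-- One step of the localization: averaging the chain rule over the revealed coordinate. The
squared norm of the pinned mean difference is bounded below by its tangent at the unpinned mean
difference. -/
lemma relEntropy_step {μ ν : Measure (Cube n)} [IsProbabilityMeasure μ] [IsProbabilityMeasure ν]
    (h : μ ≪ ν) {κ : ℝ} (hκ : 0 ≤ κ)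
    (hrec : ∀ i s, μ (face i s) ≠ 0 →
      κ * ‖mean (μ[|face i s]) - mean (ν[|face i s])‖ ^ 2
        ≤ relEntropy (μ[|face i s]) (ν[|face i s])) :
    (1 / 2 + κ * (n - 2 * influenceOpNorm ν)) * ‖mean μ - mean ν‖ ^ 2
      ≤ n * relEntropy μ ν := by
  set d : Fin n → ℝ := fun i => ∫ x, coord i x ∂μ - ∫ x, coord i x ∂ν with hd
  have hN : ‖mean μ - mean ν‖ ^ 2 = ∑ i, d i ^ 2 := norm_mean_sub_sq μ ν
  have hpin : ∀ i (s : ℤˣ), μ.real (face i s) * (κ * ∑ j, (2 * d j *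
      (∫ x, coord j x ∂μ[|face i s] - ∫ x, coord j x ∂ν[|face i s]) - d j ^ 2))
      ≤ μ.real (face i s) * relEntropy (μ[|face i s]) (ν[|face i s]) := by
    intro i s
    by_cases h0 : μ (face i s) = 0
    · simp [measureReal_def, h0]
    refine mul_le_mul_of_nonneg_left (le_trans ?_ (hrec i s h0)) measureReal_nonneg
    refine mul_le_mul_of_nonneg_left ?_ hκ
    rw [norm_mean_sub_sq]
    refine Finset.sum_le_sum fun j _ => ?_
    linarith [sq_nonneg (d j - (∫ x, coord j x ∂μ[|face i s] - ∫ x, coord j x ∂ν[|face i s]))]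
  have hface : ∀ i, d i ^ 2 / 2 + κ * (∑ j, d j ^ 2
      - 2 * ∑ j, d j * (covariance (coord j) (coord i) ν * (variance (coord i) ν)⁻¹ * d i))
      ≤ relEntropy μ ν := by
    intro i
    rw [relEntropy_chain h i]
    refine add_le_add (half_sq_le_sum_face h i)
      (le_trans (le_of_eq ?_) (Finset.sum_le_sum fun s _ => hpin i s))
    have hdrift : ∀ j, _ = d j - _ := fun j => sum_face_mean_sub h i j
    have hone : ∑ s : ℤˣ, μ.real (face i s) = 1 := by
      simpa using sum_real_face μ i
    calc _ = κ * ∑ j, (2 * d j * (d j - covariance (coord j) (coord i) ν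
              * (variance (coord i) ν)⁻¹ * d i) - 1 * d j ^ 2) := by
          rw [Finset.mul_sum, ← Finset.sum_sub_distrib]
          congr 1
          refine Finset.sum_congr rfl fun j _ => ?_
          ring
      _ = κ * ∑ j, ∑ s : ℤˣ, μ.real (face i s) * (2 * d j *
            (∫ x, coord j x ∂μ[|face i s] - ∫ x, coord j x ∂ν[|face i s]) - d j ^ 2) := by
          congr 1
          refine Finset.sum_congr rfl fun j _ => ?_
          rw [← hdrift j, ← hone, Finset.mul_sum, Finset.sum_mul, ← Finset.sum_sub_distrib]
          refine Finset.sum_congr rfl fun s _ => ?_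
          ring
      _ = _ := by
          rw [Finset.sum_comm, Finset.mul_sum]
          refine Finset.sum_congr rfl fun s _ => ?_
          rw [← Finset.mul_sum]
          ring
  have hsum := Finset.sum_le_sum fun i (_ : i ∈ Finset.univ) => hface i
  rw [Finset.sum_add_distrib, ← Finset.sum_div, ← Finset.mul_sum, Finset.sum_sub_distrib,
    ← Finset.mul_sum] at hsum
  simp only [Finset.sum_const, Finset.card_univ, Fintype.card_fin, nsmul_eq_mul] at hsum
  have hquad := sum_influence_le ν d fun i hi =>
    sub_eq_zero.2 (integral_coord_eq_of_notMem_active h hi)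
  have := mul_le_mul_of_nonneg_left hquad hκ
  rw [hN]
  linarith

lemma relEntropy_nonneg {μ ν : Measure (Cube n)} [IsProbabilityMeasure μ]
    [IsProbabilityMeasure ν] (h : μ ≪ ν) : 0 ≤ relEntropy μ ν := by
  rw [← toReal_klDiv_eq_relEntropy h]
  exact ENNReal.toReal_nonneg

/-- The transport-entropy bound after revealing `k` uniformly random coordinates one by one. The
constants `κ k = k / (2 (n + 2 α k))` satisfy `n κ (k + 1) ≤ 1 / 2 + (n - 2 α) κ k`. -/
theorem norm_mean_sub_sq_le_of_pinIndep {α : ℝ} (hα : 0 < α) (k : ℕ) :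
    ∀ (μ ν : Measure (Cube n)) [IsProbabilityMeasure μ] [IsProbabilityMeasure ν],
      μ ≪ ν → PinIndep α k ν →
      k / (2 * (n + 2 * α * k)) * ‖mean μ - mean ν‖ ^ 2 ≤ relEntropy μ ν := by
  induction k with
  | zero =>
    intro μ ν _ _ h _
    simpa using relEntropy_nonneg h
  | succ k ih =>
    intro μ ν _ _ h hν
    rcases Nat.eq_zero_or_pos n with rfl | hn
    · simpa [norm_mean_sub_sq] using relEntropy_nonneg h
    have hn : (0 : ℝ) < n := by exact_mod_cast hn
    have hk : (0 : ℝ) ≤ k := k.cast_nonneg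
    have hκ : (0 : ℝ) ≤ k / (2 * (n + 2 * α * k)) := by positivity
    have hstep := relEntropy_step h hκ fun i s hμ => by
      have := cond_isProbabilityMeasure hμ
      have := cond_isProbabilityMeasure (μ := ν) (s := face i s) fun h0 => hμ (h h0)
      exact ih _ _ (cond_ac h _) (hν.cond_face i s)
    have hop := hν.influenceOpNorm_le
    refine le_of_mul_le_mul_left (le_trans ?_ hstep) hn
    rw [← mul_assoc]
    refine mul_le_mul_of_nonneg_right ?_ (sq_nonneg _)
    calc (n : ℝ) * ((k + 1 : ℕ) / (2 * (n + 2 * α * (k + 1 : ℕ))))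
        ≤ n * ((k + 1) / (2 * (n + 2 * α * k))) := by
          push_cast
          gcongr
          linarith
      _ = 1 / 2 + k / (2 * (n + 2 * α * k)) * (n - 2 * α) := by field_simp; ring
      _ ≤ _ := by gcongr

/-- A sign pattern with at most `⌈c n⌉` nonzero entries is the sign vector of itself. -/
lemma L2IndepOn.pinIndep {α c : ℝ} {ν : Measure (Cube n)}
    (h : L2IndepOn α (signSet (sparse n c)) ν) : PinIndep α ⌈c * n⌉₊ ν := by
  intro u hu
  refine h u ⟨WithLp.toLp 2 fun i => ((u i : SignType) : ℝ), ?_, fun i => Or.inr ?_⟩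
  · have : {i | ((u i : SignType) : ℝ) ≠ 0} = ↑(Finset.univ.filter fun i => u i ≠ 0) := by
      ext i
      cases hi : u i <;> simp [hi]
    simp only [sparse, Set.mem_ofPred_eq]
    rw [this, Set.ncard_coe_finset]
    exact hu
  · cases hi : u i <;> simp [hi]

end SparseLoc
end

theorem theorem1p4 (n : ℕ) (c α : ℝ) (hc0 : 0 < c) (hc1 : c ≤ 1) (hα : 0 < α)
    (ν : MeasureTheory.Measure (SparseLoc.Cube n)) [MeasureTheory.IsProbabilityMeasure ν]
    (hν : SparseLoc.L2IndepOn α (SparseLoc.signSet (SparseLoc.sparse n c)) ν)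
    (μ : MeasureTheory.Measure (SparseLoc.Cube n)) [MeasureTheory.IsProbabilityMeasure μ]
    (hμν : MeasureTheory.Measure.AbsolutelyContinuous μ ν) :
    ‖SparseLoc.mean μ - SparseLoc.mean ν‖ ^ 2
      ≤ 8 * α / c * (InformationTheory.klDiv μ ν).toReal := by
  have hpin := hν.pinIndep
  rw [SparseLoc.toReal_klDiv_eq_relEntropy hμν]
  by_cases hact : SparseLoc.active ν = ∅
  · -- every coordinate is deterministic, so the two means agree
    have h0 : ‖SparseLoc.mean μ - SparseLoc.mean ν‖ ^ 2 = 0 := by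
      rw [SparseLoc.norm_mean_sub_sq]
      refine Finset.sum_eq_zero fun i _ => ?_
      rw [SparseLoc.integral_coord_eq_of_notMem_active hμν (by simp [hact]), sub_self, sq, mul_zero]
    rw [h0]
    exact mul_nonneg (by positivity) (SparseLoc.relEntropy_nonneg hμν)
  obtain ⟨i, hi⟩ := Finset.nonempty_iff_ne_empty.2 hact
  have hα1 : 1 ≤ α := (SparseLoc.one_le_influenceOpNorm ⟨i, hi⟩).trans hpin.influenceOpNorm_le
  have hn : (0 : ℝ) < n := by exact_mod_cast i.pos
  have hmain := SparseLoc.norm_mean_sub_sq_le_of_pinIndep hα ⌈c * n⌉₊ μ ν hμν hpin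
  set k : ℝ := (⌈c * n⌉₊ : ℝ)
  have hk : c * n ≤ k := Nat.le_ceil _
  have hk0 : 0 < k := (mul_pos hc0 hn).trans_le hk
  have hκ : c / (8 * α) ≤ k / (2 * (n + 2 * α * k)) := by
    rw [div_le_div_iff₀ (by positivity) (by positivity)]
    -- `2 c n ≤ 2 k` and `4 α c k ≤ 4 α k`, and `2 + 4 α ≤ 8 α`
    have h1 : c * (α * k) ≤ 1 * (α * k) := by gcongr
    have h2 : 1 * k ≤ α * k := by gcongr
    linarith
  rw [div_mul_eq_mul_div, le_div_iff₀ hc0]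
  have h3 := (mul_le_mul_of_nonneg_right hκ (sq_nonneg _)).trans hmain
  rw [div_mul_eq_mul_div, div_le_iff₀ (by positivity)] at h3
  linarith
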